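/- **Theorem.** Fix $d\ge 1$. For $x\in\mathbb Z^d$ let $\mathcal K^*_x=\{y\neq x:\ y_i-x_i\in\{0,1\}\text{ for all }i\}$, and for a finite $\Lambda\subset\mathbb Z^d$ let $\partial^*_+\Lambda=\bigl(\bigcup_{x\in\Lambda}\mathcal K^*_x\bigr)\setminus\Lambda$. Let $(S,\nu)$ be a finite probability space with $\nu(s)>0$ for every $s\in S$, let $G\subset S$ and $q=\nu(G)$. For $\omega\in\Omega=S^{\mathbb Z^d}$ put $c_x(\omega)=1$ if $\omega_y\in G$ for all $y\in\mathcal K^*_x$, and $c_x(\omega)=0$ otherwise (the *-general model). Write $\operatorname{Var}_x(f)$ for the variance of $f$ with respect to $\nu(d\omega_x)$, all other coordinates being fixed. *Finite volume.* For a finite $\Lambda\subset\mathbb Z^d$ and a boundary condition $\tau\in\Omega$ with $\tau_y\in G$ for all $y\in\partial^*_+\Lambda$, let $\mu_\Lambda=\nu^{\otimes\Lambda}$, let $c_{x,\Lambda}(\omega)=c_x(\omega\cdot\tau)$, where $\omega\cdot\tau$ equals $\omega$ in $\Lambda$ and $\tau$ outside, and set $$\mathcal D_\Lambda(f)=\sum_{x\in\Lambda}\mu_\Lambda\bigl(c_{x,\Lambda}\operatorname{Var}_x(f)\bigr),\qquad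 \operatorname{gap}(\mathcal L_\Lambda)=\inf_{f:S^\Lambda\to\mathbb R,\ f\ne\mathrm{const}}\frac{\mathcal D_\Lambda(f)}{\operatorname{Var}_{\mu_\Lambda}(f)} ;$$ this does not depend on the choice of such a $\tau$. *Infinite volume.* Let $\mu=\nu^{\otimes\mathbb Z^d}$, and let $\mathcal L$ be the generator on $L^2(\Omega,\mu)$, that is, the closure of the operator $\mathcal Lf(\omega)=\sum_x c_x(\omega)\bigl(\int f\,d\nu(\omega_x)-f(\omega)\bigr)$ defined on the functions that depend on finitely many coordinates. Set $$\mathcal D(f)=\sum_{x\in\mathbb Z^d}\mu\bigl(c_x\operatorname{Var}_x(f)\bigr),\qquad \operatorname{gap}(\mathcal L)=\inf_{f\in \mathrm{Dom}(\mathcal L),\ f\neq\mathrm{const}}\frac{\mathcal D(f)}{\operatorname{Var}_\mu(f)} .$$ (An infimum over the empty set, which occurs if $\Lambda=\emptyset$ or $|S|=1$, is $+\infty$.) Then there exists $q_0<1$, depending only on $d$ and not on $S$, $\nu$ or $G$, such that whenever $q>q_0$, $$\inf_{\Lambda\subset\mathbb Z^d\ \text{finite}}\operatorname{gap}(\mathcal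 L_\Lambda)>\tfrac12 ,$$ and moreover $\operatorname{gap}(\mathcal L)>0$. -/

import Mathlib

open MeasureTheory ProbabilityTheory
open scoped ENNReal

namespace KCSM

/-- The lattice `ℤ^d`. -/
abbrev Site (d : ℕ) : Type := Fin d → ℤ

/-- The `*`-oriented neighbourhood `K*_x`: all `y ≠ x` of the form `x + ∑ αᵢ eᵢ`, `αᵢ ∈ {0, 1}`. -/
def starOrientedNbhd {d : ℕ} (x : Site d) : Set (Site d) :=
  {y | y ≠ x ∧ ∀ i, y i = x i ∨ y i = x i + 1}

/-- The `*`-oriented boundary `∂*₊ Λ = (⋃_{x ∈ Λ} K*_x) \ Λ`. -/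
def starOrientedBoundary {d : ℕ} (Λ : Finset (Site d)) : Set (Site d) :=
  (⋃ x ∈ Λ, starOrientedNbhd x) \ (Λ : Set (Site d))

/-- The influence classes of the `*`-general model: `C_x = {K*_x}`. -/
def starInfluence {d : ℕ} (x : Site d) : Set (Set (Site d)) := {starOrientedNbhd x}

section Constraint

variable {d : ℕ} {S : Type*}

open Classical in
/-- The constraint `c_x(ω)` attached to influence classes `C` and good set `G`: it equals `1` if
some `A ∈ C_x` satisfies `ω_y ∈ G` for all `y ∈ A`, and `0` otherwise. -/
noncomputable def constraint (C : Site d → Set (Set (Site d))) (G : Set S) (x : Site d)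
    (ω : Site d → S) : ℝ :=
  if ∃ A ∈ C x, ∀ y ∈ A, ω y ∈ G then 1 else 0

/-- `ω_Λ · τ`: the configuration equal to `ω` inside `Λ` and to `τ` outside. -/
def glue (Λ : Finset (Site d)) (ω : Λ → S) (τ : Site d → S) : Site d → S :=
  fun y => if h : y ∈ Λ then ω ⟨y, h⟩ else τ y

end Constraint

section Local

variable {d : ℕ} {S : Type*}

/-- A function on `Ω` is local if it depends on finitely many coordinates. -/
def IsLocal (φ : (Site d → S) → ℝ) : Prop :=
  ∃ Λ : Finset (Site d), DependsOn φ (Λ : Set (Site d))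

theorem IsLocal.add {φ ψ : (Site d → S) → ℝ} (hφ : IsLocal φ) (hψ : IsLocal ψ) :
    IsLocal (φ + ψ) := by
  classical
  obtain ⟨Λ, hΛ⟩ := hφ
  obtain ⟨Λ', hΛ'⟩ := hψ
  refine ⟨Λ ∪ Λ', fun a b h => ?_⟩
  have h1 := hΛ fun i hi => h i (by simp at hi ⊢; exact Or.inl hi)
  have h2 := hΛ' fun i hi => h i (by simp at hi ⊢; exact Or.inr hi)
  simp [h1, h2]

theorem IsLocal.smul {φ : (Site d → S) → ℝ} (a : ℝ) (hφ : IsLocal φ) : IsLocal (a • φ) := by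
  obtain ⟨Λ, hΛ⟩ := hφ
  exact ⟨Λ, fun u v h => by simp [hΛ h]⟩

end Local

section FiniteVolume

variable {d : ℕ} {S : Type*} [MeasurableSpace S]

/-- The finite-volume Dirichlet form with boundary condition `τ`,
`D_Λ(f) = ∑_{x ∈ Λ} μ_Λ (c^τ_{x,Λ} Var_x f)`, where `c^τ_{x,Λ}(ω) = c_x(ω · τ)` and `μ_Λ = ν^Λ`. -/
noncomputable def finiteDirichlet (C : Site d → Set (Set (Site d))) (G : Set S) (ν : Measure S)
    [IsProbabilityMeasure ν] (Λ : Finset (Site d)) (τ : Site d → S) (f : (Λ → S) → ℝ) : ℝ≥0∞ :=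
  ∑ x : Λ, ∫⁻ ω, ENNReal.ofReal (constraint C G x (glue Λ ω τ)) *
    evariance (fun s => f (Function.update ω x s)) ν ∂(Measure.pi fun _ : Λ => ν)

/-- The finite-volume spectral gap with boundary condition `τ`: the infimum of
`D_Λ(f) / Var_Λ(f)` over the non-constant functions `f` on `S^Λ` (`∞` if there are none). -/
noncomputable def finiteGap (C : Site d → Set (Set (Site d))) (G : Set S) (ν : Measure S)
    [IsProbabilityMeasure ν] (Λ : Finset (Site d)) (τ : Site d → S) : ℝ≥0∞ :=
  ⨅ (f : (Λ → S) → ℝ) (_ : ¬ ∃ a : ℝ, ∀ ω, f ω = a),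
    finiteDirichlet C G ν Λ τ f / evariance f (Measure.pi fun _ : Λ => ν)

end FiniteVolume

section InfiniteVolume

variable {d : ℕ} {S : Type*} [MeasurableSpace S]

/-- The product measure `μ = ν^{ℤ^d}` on `Ω = S^{ℤ^d}`. -/
noncomputable def productMeasure (d : ℕ) (ν : Measure S) [IsProbabilityMeasure ν] :
    Measure (Site d → S) :=
  Measure.infinitePi fun _ : Site d => ν

/-- The term of the generator at the site `x`: `c_x(ω) (∫ φ dν(ω_x) - φ(ω))`. -/
noncomputable def siteGen (C : Site d → Set (Set (Site d))) (G : Set S) (ν : Measure S)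
    (φ : (Site d → S) → ℝ) (ω : Site d → S) (x : Site d) : ℝ :=
  constraint C G x ω * (∫ s, φ (Function.update ω x s) ∂ν - φ ω)

/-- The generator on a local function `φ`: `(L φ)(ω) = ∑_x c_x(ω) (∫ φ dν(ω_x) - φ(ω))`. Only
finitely many terms differ from zero. -/
noncomputable def localGen (C : Site d → Set (Set (Site d))) (G : Set S) (ν : Measure S)
    (φ : (Site d → S) → ℝ) (ω : Site d → S) : ℝ :=
  ∑ᶠ x, siteGen C G ν φ ω x

theorem siteGen_support_finite [Finite S] [MeasurableSingletonClass S]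
    (C : Site d → Set (Set (Site d))) (G : Set S) (ν : Measure S) [IsProbabilityMeasure ν]
    {φ : (Site d → S) → ℝ} (hφ : IsLocal φ) (ω : Site d → S) :
    (Function.support (siteGen C G ν φ ω)).Finite := by
  obtain ⟨Λ, hΛ⟩ := hφ
  refine Λ.finite_toSet.subset fun x hx => ?_
  by_contra hxΛ
  refine hx ?_
  have h : ∀ s, φ (Function.update ω x s) = φ ω := fun s =>
    hΛ fun y hy => Function.update_of_ne (fun (h : y = x) => hxΛ (h ▸ hy)) _ _
  simp [siteGen, h]

theorem localGen_add [Finite S] [MeasurableSingletonClass S]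
    (C : Site d → Set (Set (Site d))) (G : Set S) (ν : Measure S) [IsProbabilityMeasure ν]
    {φ ψ : (Site d → S) → ℝ} (hφ : IsLocal φ) (hψ : IsLocal ψ) :
    localGen C G ν (φ + ψ) = localGen C G ν φ + localGen C G ν ψ := by
  funext ω
  simp only [localGen, Pi.add_apply]
  rw [← finsum_add_distrib (siteGen_support_finite C G ν hφ ω)
    (siteGen_support_finite C G ν hψ ω)]
  refine finsum_congr fun x => ?_
  simp only [siteGen, Pi.add_apply]
  rw [integral_add (.of_finite) (.of_finite)]
  ring

theorem localGen_smul (C : Site d → Set (Set (Site d))) (G : Set S) (ν : Measure S) (a : ℝ)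
    (φ : (Site d → S) → ℝ) : localGen C G ν (a • φ) = a • localGen C G ν φ := by
  funext ω
  simp only [localGen, Pi.smul_apply]
  rw [smul_finsum]
  refine finsum_congr fun x => ?_
  simp only [siteGen, Pi.smul_apply, smul_eq_mul, integral_const_mul]
  ring

/-- The graph `{(φ, L φ) : φ local}` in `L²(μ) × L²(μ)`. -/
noncomputable def localGraph [Finite S] [MeasurableSingletonClass S]
    (C : Site d → Set (Set (Site d))) (G : Set S) (ν : Measure S) [IsProbabilityMeasure ν] :
    Submodule ℝ (Lp ℝ 2 (productMeasure d ν) × Lp ℝ 2 (productMeasure d ν)) where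
  carrier := {p | ∃ φ : (Site d → S) → ℝ, IsLocal φ ∧ p.1 =ᵐ[productMeasure d ν] φ ∧
    p.2 =ᵐ[productMeasure d ν] localGen C G ν φ}
  zero_mem' := by
    refine ⟨0, ⟨∅, fun _ _ _ => rfl⟩, Lp.coeFn_zero _ _ _, ?_⟩
    have h : localGen C G ν (0 : (Site d → S) → ℝ) = 0 := by
      simpa using localGen_smul C G ν 0 0
    rw [h]
    exact Lp.coeFn_zero _ _ _
  add_mem' := by
    rintro p p' ⟨φ, hφ, h1, h2⟩ ⟨ψ, hψ, h1', h2'⟩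
    refine ⟨φ + ψ, hφ.add hψ, (Lp.coeFn_add _ _).trans (h1.add h1'), ?_⟩
    rw [localGen_add C G ν hφ hψ]
    exact (Lp.coeFn_add _ _).trans (h2.add h2')
  smul_mem' := by
    rintro a p ⟨φ, hφ, h1, h2⟩
    refine ⟨a • φ, hφ.smul a, (Lp.coeFn_smul _ _).trans (h1.const_smul a), ?_⟩
    rw [localGen_smul]
    exact (Lp.coeFn_smul _ _).trans (h2.const_smul a)

/-- The generator `L` on `L²(μ)`: the closure of its restriction to the local functions, that is,
the operator whose graph is the closure of `{(φ, L φ) : φ local}` in `L²(μ) × L²(μ)`. -/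
noncomputable def generator [Finite S] [MeasurableSingletonClass S]
    (C : Site d → Set (Set (Site d))) (G : Set S) (ν : Measure S) [IsProbabilityMeasure ν] :
    Lp ℝ 2 (productMeasure d ν) →ₗ.[ℝ] Lp ℝ 2 (productMeasure d ν) :=
  (localGraph C G ν).topologicalClosure.toLinearPMap

/-- The Dirichlet form `D(f) = ∑_x μ (c_x Var_x f)`. -/
noncomputable def dirichlet (C : Site d → Set (Set (Site d))) (G : Set S) (ν : Measure S)
    [IsProbabilityMeasure ν] (f : (Site d → S) → ℝ) : ℝ≥0∞ :=
  ∑' x : Site d, ∫⁻ ω, ENNReal.ofReal (constraint C G x ω) *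
    evariance (fun s => f (Function.update ω x s)) ν ∂(productMeasure d ν)

/-- The spectral gap of `L` on `Ω = S^{ℤ^d}`: the infimum of `D(f) / Var(f)` over the `f ∈ Dom(L)` that are not
almost everywhere constant (`∞` if there are none). -/
noncomputable def gap [Finite S] [MeasurableSingletonClass S]
    (C : Site d → Set (Set (Site d))) (G : Set S) (ν : Measure S) [IsProbabilityMeasure ν] :
    ℝ≥0∞ :=
  ⨅ (f : Lp ℝ 2 (productMeasure d ν)) (_ : f ∈ (generator C G ν).domain)
    (_ : ¬ ∃ a : ℝ, ∀ᵐ ω ∂(productMeasure d ν), f ω = a),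
    dirichlet C G ν f / evariance f (productMeasure d ν)

end InfiniteVolume

end KCSM

/-! Rank the sites of a finite volume lexicographically: every site of `K*_x` ranks above `x`.
Revealing sites by increasing rank splits the variance orthogonally into increments `D_x`, where
`D_x` averages `h = f - E_x f` over all sites above `x` (`sum_sqNorm_increment`). Write `h = c_x h +
(1 - c_x) h`. The first part contributes at most `μ(c_x Var_x f)`, since averaging contracts. In the
second part `1 - c_x` depends only on the sites in `K*_x`, so conditional Cauchy-Schwarz gives the
small factor `μ(1 - c_x) ≤ 2^d (1 - q)` times the squared norm of `h` averaged over the sites above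
`x` but outside `K*_x`. That norm is bounded by the increments at `x` and at the sites of `K*_x`
(`sqNorm_avg_sdiff_le`). Each site lies in at most `2^d` neighbourhoods, so for `q` near `1` the
errors sum to at most an eighth of the variance and are absorbed, leaving gap at least `7/10`
(`constrained_poincare`, `le_finiteGap`).

In infinite volume, approximation by local functions in `L²` does not by itself control a Dirichlet
sum over infinitely many sites. The Poincaré inequality is therefore proved with resamplings only in
a finite set `T`, at the cost of the distance from `f` to a function `ψ` of the coordinates in `T`.
With `T` fixed, the remaining finite sum is continuous in `L²`, and the inequality passes to the
domain of the generator (`evariance_le_dirichlet`). -/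

namespace KCSM

/-! ### Resampling a coordinate of a product measure. -/

section Resampling

variable {ι S : Type*} [DecidableEq ι] [MeasurableSpace S] (ν : Measure S)
  [IsProbabilityMeasure ν]

/-- Resampling one coordinate preserves a product measure. -/
theorem measurePreserving_update (i : ι) :
    MeasurePreserving (fun p : (ι → S) × S => Function.update p.1 i p.2)
      ((Measure.infinitePi fun _ : ι => ν).prod ν) (Measure.infinitePi fun _ : ι => ν) := by
  have hm : Measurable (fun p : (ι → S) × S => Function.update p.1 i p.2) := by
    refine measurable_pi_lambda _ fun j => ?_
    by_cases h : j = i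
    · subst h; simpa using measurable_snd
    · simp only [Function.update_of_ne h]
      fun_prop
  refine ⟨hm, Measure.eq_infinitePi _ fun s t ht => ?_⟩
  rw [Measure.map_apply hm (.pi s.countable_toSet fun j _ => ht j)]
  by_cases hi : i ∈ s
  · have : (fun p : (ι → S) × S => Function.update p.1 i p.2) ⁻¹' (Set.pi s t) =
        (Set.pi (s.erase i : Finset ι) t) ×ˢ (t i) := by
      ext ⟨ω, a⟩
      simp only [Set.mem_preimage, Set.mem_pi, Set.mem_prod, Finset.mem_coe, Finset.mem_erase]
      constructor
      · exact fun h => ⟨fun j hj => by simpa [hj.1] using h j hj.2, by simpa using h i hi⟩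
      · rintro ⟨h1, h2⟩ j hj
        by_cases hji : j = i
        · subst hji; simpa using h2
        · simpa [hji] using h1 j ⟨hji, hj⟩
    rw [this, Measure.prod_prod, Measure.infinitePi_pi _ fun j _ => ht j,
      Finset.prod_erase_mul _ _ hi]
  · have : (fun p : (ι → S) × S => Function.update p.1 i p.2) ⁻¹' (Set.pi s t) =
        (Set.pi s t) ×ˢ Set.univ := by
      ext ⟨ω, a⟩
      simp only [Set.mem_preimage, Set.mem_pi, Set.mem_prod, Finset.mem_coe, Set.mem_univ,
        and_true]
      refine forall₂_congr fun j hj => ?_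
      have hji : j ≠ i := fun h => hi (h ▸ hj)
      simp [hji]
    rw [this, Measure.prod_prod, Measure.infinitePi_pi _ fun j _ => ht j]
    simp

/-- Integrating out one coordinate and then the others is integrating. -/
theorem lintegral_lintegral_update (i : ι) {g : (ι → S) → ℝ≥0∞} (hg : Measurable g) :
    ∫⁻ ω, ∫⁻ s, g (Function.update ω i s) ∂ν ∂(Measure.infinitePi fun _ : ι => ν) =
      ∫⁻ ω, g ω ∂(Measure.infinitePi fun _ : ι => ν) := by
  have h := measurePreserving_update ν i
  rw [← h.lintegral_comp hg]
  exact (lintegral_prod _ (hg.comp h.measurable).aemeasurable).symm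

end Resampling

/-! ### Commuting coordinate averages as conditional expectations. -/

section Averaging

variable {ι S : Type*} [DecidableEq ι] [Finite S] [MeasurableSpace S]
  [MeasurableSingletonClass S] (ν : Measure S) [IsProbabilityMeasure ν]

/-- Averaging over the coordinate `i`. -/
noncomputable def siteAvg (i : ι) : Module.End ℝ ((ι → S) → ℝ) where
  toFun f ω := ∫ s, f (Function.update ω i s) ∂ν
  map_add' f g := by
    funext ω
    exact integral_add .of_finite .of_finite
  map_smul' a f := by
    funext ω
    exact integral_const_mul a _

theorem siteAvg_apply (i : ι) (f : (ι → S) → ℝ) (ω : ι → S) :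
    siteAvg ν i f ω = ∫ s, f (Function.update ω i s) ∂ν := rfl

/-- A function that does not depend on the coordinate `i`. -/
def IndepOf (i : ι) (f : (ι → S) → ℝ) : Prop := ∀ ω s, f (Function.update ω i s) = f ω

theorem indepOf_siteAvg (i : ι) (f : (ι → S) → ℝ) : IndepOf i (siteAvg ν i f) :=
  fun ω s => by simp [siteAvg_apply]

theorem IndepOf.siteAvg {i : ι} {f : (ι → S) → ℝ} (hf : IndepOf i f) (j : ι) :
    IndepOf i (siteAvg ν j f) := by
  by_cases h : i = j
  · subst h; exact indepOf_siteAvg ν i f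
  · intro ω s
    simp only [siteAvg_apply]
    congr 1
    funext t
    rw [Function.update_comm h, hf]

theorem siteAvg_mul {i : ι} {g : (ι → S) → ℝ} (hg : IndepOf i g) (f : (ι → S) → ℝ) :
    siteAvg ν i (g * f) = g * siteAvg ν i f := by
  funext ω
  simp only [siteAvg_apply, Pi.mul_apply, hg ω, integral_const_mul]

theorem siteAvg_of_indepOf {i : ι} {f : (ι → S) → ℝ} (hf : IndepOf i f) :
    siteAvg ν i f = f := by
  funext ω
  simp [siteAvg_apply, hf ω]

theorem siteAvg_nonneg (i : ι) {f : (ι → S) → ℝ} (hf : 0 ≤ f) : 0 ≤ siteAvg ν i f :=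
  fun _ => integral_nonneg fun _ => hf _

theorem siteAvg_commute (i j : ι) : Commute (siteAvg (S := S) ν i) (siteAvg ν j) := by
  by_cases h : i = j
  · subst h; exact Commute.refl _
  · refine LinearMap.ext fun f => funext fun ω => ?_
    change ∫ s, ∫ t, f (Function.update (Function.update ω i s) j t) ∂ν ∂ν =
      ∫ t, ∫ s, f (Function.update (Function.update ω j t) i s) ∂ν ∂ν
    rw [integral_integral_swap .of_finite]
    simp_rw [Function.update_comm h]

theorem pairwise_commute_siteAvg (A : Finset ι) :
    (A : Set ι).Pairwise (Function.onFun Commute (siteAvg (S := S) ν)) :=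
  fun i _ j _ _ => siteAvg_commute ν i j

/-- Averaging over the coordinates in `A`. -/
noncomputable def avg (A : Finset ι) : Module.End ℝ ((ι → S) → ℝ) :=
  A.noncommProd (siteAvg ν) (pairwise_commute_siteAvg ν A)

@[simp] theorem avg_empty (f : (ι → S) → ℝ) : avg ν ∅ f = f := by
  rw [avg, Finset.noncommProd_empty, Module.End.one_apply]

theorem avg_insert {i : ι} {A : Finset ι} (h : i ∉ A) (f : (ι → S) → ℝ) :
    avg ν (insert i A) f = siteAvg ν i (avg ν A f) := by
  rw [avg, Finset.noncommProd_insert_of_notMem _ _ _ _ h, Module.End.mul_apply, avg]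

theorem avg_siteAvg (A : Finset ι) (i : ι) (f : (ι → S) → ℝ) :
    avg ν A (siteAvg ν i f) = siteAvg ν i (avg ν A f) := by
  have h : Commute (siteAvg ν i) (avg ν A) :=
    Finset.noncommProd_commute _ _ _ _ fun j _ => siteAvg_commute ν i j
  exact (LinearMap.congr_fun h.eq f).symm

theorem avg_union {A B : Finset ι} (h : Disjoint A B) (f : (ι → S) → ℝ) :
    avg ν (A ∪ B) f = avg ν A (avg ν B f) := by
  rw [avg, Finset.noncommProd_union_of_disjoint h, Module.End.mul_apply, avg, avg]

theorem avg_sub_siteAvg (A : Finset ι) (i : ι) (f : (ι → S) → ℝ) :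
    avg ν A (f - siteAvg ν i f) = avg ν A f - siteAvg ν i (avg ν A f) := by
  rw [map_sub, avg_siteAvg]

theorem IndepOf.avg {i : ι} {f : (ι → S) → ℝ} (hf : IndepOf i f) (A : Finset ι) :
    IndepOf i (avg ν A f) := by
  induction A using Finset.induction_on with
  | empty => simpa
  | insert j A hj ih => rw [avg_insert ν hj]; exact ih.siteAvg ν j

theorem indepOf_avg {i : ι} {A : Finset ι} (hi : i ∈ A) (f : (ι → S) → ℝ) :
    IndepOf i (avg ν A f) := by
  rw [← Finset.insert_erase hi, avg_insert ν (Finset.notMem_erase i A)]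
  exact indepOf_siteAvg ν i _

theorem avg_mul {A : Finset ι} {g : (ι → S) → ℝ} (hg : ∀ i ∈ A, IndepOf i g)
    (f : (ι → S) → ℝ) : avg ν A (g * f) = g * avg ν A f := by
  induction A using Finset.induction_on with
  | empty => simp
  | insert j A hj ih =>
    rw [avg_insert ν hj, avg_insert ν hj, ih fun i hi => hg i (Finset.mem_insert_of_mem hi),
      siteAvg_mul ν (hg j (Finset.mem_insert_self _ _))]

theorem avg_of_indepOf {A : Finset ι} {f : (ι → S) → ℝ} (hf : ∀ i ∈ A, IndepOf i f) :
    avg ν A f = f := by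
  induction A using Finset.induction_on with
  | empty => simp
  | insert j A hj ih =>
    rw [avg_insert ν hj, ih fun i hi => hf i (Finset.mem_insert_of_mem hi),
      siteAvg_of_indepOf ν (hf j (Finset.mem_insert_self _ _))]

theorem avg_nonneg (A : Finset ι) {f : (ι → S) → ℝ} (hf : 0 ≤ f) : 0 ≤ avg ν A f := by
  induction A using Finset.induction_on with
  | empty => simpa
  | insert j A hj ih => rw [avg_insert ν hj]; exact siteAvg_nonneg ν j ih

variable [Fintype ι]

theorem integral_siteAvg (i : ι) (f : (ι → S) → ℝ) :
    ∫ ω, siteAvg ν i f ω ∂(Measure.pi fun _ : ι => ν) =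
      ∫ ω, f ω ∂(Measure.pi fun _ : ι => ν) := by
  have h := measurePreserving_update ν i
  rw [Measure.infinitePi_eq_pi] at h
  conv_rhs => rw [← h.map_eq, integral_map h.measurable.aemeasurable .of_discrete,
    integral_prod _ .of_finite]
  rfl

theorem integral_avg (A : Finset ι) (f : (ι → S) → ℝ) :
    ∫ ω, avg ν A f ω ∂(Measure.pi fun _ : ι => ν) = ∫ ω, f ω ∂(Measure.pi fun _ : ι => ν) := by
  induction A using Finset.induction_on with
  | empty => simp
  | insert j A hj ih => rw [avg_insert ν hj, integral_siteAvg, ih]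

theorem avg_univ (f : (ι → S) → ℝ) (ω : ι → S) :
    avg ν Finset.univ f ω = ∫ η, f η ∂(Measure.pi fun _ : ι => ν) := by
  -- The full average is independent of each coordinate; changing the coordinates one at a time
  -- shows that it is constant.
  have key : ∀ (A : Finset ι) (η : ι → S),
      avg ν Finset.univ f (fun i => if i ∈ A then η i else ω i) = avg ν Finset.univ f ω := by
    intro A η
    induction A using Finset.induction_on with
    | empty => simp
    | insert j A hj ih =>
      refine Eq.trans (Eq.trans (indepOf_avg ν (Finset.mem_univ j) f _ (ω j)).symm
        (congrArg (avg ν Finset.univ f) (funext fun i => ?_))) ih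
      by_cases h : i = j
      · subst h; simp [hj]
      · simp [h]
  have : ∀ η, avg ν Finset.univ f η = avg ν Finset.univ f ω := fun η => by
    simpa using key Finset.univ η
  rw [← integral_avg ν Finset.univ f]
  simp [this]

/-- The squared norm in `L²` of the product measure. -/
noncomputable def sqNorm (f : (ι → S) → ℝ) : ℝ := ∫ ω, f ω ^ 2 ∂(Measure.pi fun _ : ι => ν)

theorem sqNorm_nonneg (f : (ι → S) → ℝ) : 0 ≤ sqNorm ν f := integral_nonneg fun _ => sq_nonneg _

theorem integral_mul_siteAvg (i : ι) (f : (ι → S) → ℝ) :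
    ∫ ω, (f * siteAvg ν i f) ω ∂(Measure.pi fun _ : ι => ν) = sqNorm ν (siteAvg ν i f) := by
  rw [← integral_siteAvg ν i, mul_comm, siteAvg_mul ν (indepOf_siteAvg ν i f), sqNorm]
  simp [sq]

/-- Pythagoras: averaging over one coordinate is an orthogonal projection in `L²`. -/
theorem sqNorm_eq_add (i : ι) (f : (ι → S) → ℝ) :
    sqNorm ν f = sqNorm ν (siteAvg ν i f) + sqNorm ν (f - siteAvg ν i f) := by
  have h := integral_mul_siteAvg ν i f
  have : sqNorm ν (f - siteAvg ν i f) = sqNorm ν f -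
      2 * ∫ ω, (f * siteAvg ν i f) ω ∂(Measure.pi fun _ : ι => ν) +
      sqNorm ν (siteAvg ν i f) := by
    simp only [sqNorm]
    rw [← integral_const_mul, ← integral_sub .of_finite .of_finite,
      ← integral_add .of_finite .of_finite]
    congr 1
    funext ω
    simp only [Pi.sub_apply, Pi.mul_apply]
    ring
  linarith

theorem sqNorm_avg_le (A : Finset ι) (f : (ι → S) → ℝ) : sqNorm ν (avg ν A f) ≤ sqNorm ν f := by
  induction A using Finset.induction_on with
  | empty => simp
  | insert j A hj ih =>
    rw [avg_insert ν hj]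
    have := sqNorm_eq_add ν j (avg ν A f)
    have := sqNorm_nonneg ν (avg ν A f - siteAvg ν j (avg ν A f))
    linarith

/-- Conditional Cauchy-Schwarz, from the discriminant of the nonnegative quadratic `t ↦ avg ν A ((t
• f + g) ^ 2) ω`. -/
theorem avg_mul_sq_le (A : Finset ι) (f g : (ι → S) → ℝ) (ω : ι → S) :
    avg ν A (f * g) ω ^ 2 ≤ avg ν A (f ^ 2) ω * avg ν A (g ^ 2) ω := by
  have h : ∀ t : ℝ, 0 ≤ avg ν A (f ^ 2) ω * (t * t) + (2 * avg ν A (f * g) ω) * t +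
      avg ν A (g ^ 2) ω := by
    intro t
    have h0 : 0 ≤ avg ν A ((t • f + g) ^ 2) ω := avg_nonneg ν A (fun _ => sq_nonneg _) ω
    have h1 : (t • f + g) ^ 2 = (t * t) • f ^ 2 + (2 * t) • (f * g) + g ^ 2 := by
      funext η
      simp only [Pi.pow_apply, Pi.add_apply, Pi.smul_apply, smul_eq_mul, Pi.mul_apply]
      ring
    rw [h1, map_add, map_add, map_smul, map_smul] at h0
    simp only [Pi.add_apply, Pi.smul_apply, smul_eq_mul] at h0
    linarith
  have := discrim_le_zero h
  rw [discrim] at this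
  nlinarith

end Averaging

/-! ### Martingale increments and the abstract constrained Poincaré inequality. -/

section Martingale

variable {ι S α : Type*} [Fintype ι] [DecidableEq ι] [LinearOrder α] [Finite S]
  [MeasurableSpace S] [MeasurableSingletonClass S] (ν : Measure S) [IsProbabilityMeasure ν]

/-- The sites ranked strictly above `x`. -/
def sitesAbove (r : ι → α) (x : ι) : Finset ι := {y | r x < r y}

theorem mem_sitesAbove {r : ι → α} {x y : ι} : y ∈ sitesAbove r x ↔ r x < r y := by
  simp [sitesAbove]

/-- The martingale increment at `x` obtained by revealing the sites by increasing rank. -/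
noncomputable def increment (r : ι → α) (f : (ι → S) → ℝ) (x : ι) : (ι → S) → ℝ :=
  avg ν (sitesAbove r x) (f - siteAvg ν x f)

theorem sqNorm_sub_siteAvg_le (i : ι) (f : (ι → S) → ℝ) :
    sqNorm ν (f - siteAvg ν i f) ≤ sqNorm ν f := by
  have := sqNorm_eq_add ν i f
  have := sqNorm_nonneg ν (siteAvg ν i f)
  linarith

theorem sqNorm_avg_le_of_subset {A B : Finset ι} (h : A ⊆ B) (f : (ι → S) → ℝ) :
    sqNorm ν (avg ν B f) ≤ sqNorm ν (avg ν A f) := by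
  rw [← Finset.sdiff_union_of_subset h, avg_union ν Finset.sdiff_disjoint]
  exact sqNorm_avg_le ν _ _

/-- Orthogonality of the martingale increments. -/
theorem sum_sqNorm_increment {r : ι → α} (hr : Function.Injective r) (f : (ι → S) → ℝ) :
    ∑ x, sqNorm ν (increment ν r f x) =
      sqNorm ν f - (∫ ω, f ω ∂(Measure.pi fun _ : ι => ν)) ^ 2 := by
  -- The identity is proved for averages restricted to `A`, so that inserting a new site of lowest
  -- rank leaves the earlier terms unchanged and adds one instance of Pythagoras.
  have key : ∀ A : Finset ι,
      ∑ x ∈ A, sqNorm ν (avg ν (A ∩ sitesAbove r x) (f - siteAvg ν x f)) =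
        sqNorm ν f - sqNorm ν (avg ν A f) := by
    intro A
    induction A using Finset.induction_on_min_value r with
    | empty => simp
    | insert a s ha hmin ih =>
      have h1 : insert a s ∩ sitesAbove r a = s := by
        ext y
        simp only [Finset.mem_inter, Finset.mem_insert, mem_sitesAbove]
        constructor
        · rintro ⟨rfl | h, h'⟩
          · exact absurd h' (lt_irrefl _)
          · exact h
        · exact fun h => ⟨Or.inr h, lt_of_le_of_ne (hmin y h) fun e => ha (hr e ▸ h)⟩
      have h2 : ∀ x ∈ s, insert a s ∩ sitesAbove r x = s ∩ sitesAbove r x := by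
        intro x hx
        refine Finset.insert_inter_of_notMem fun h => ?_
        exact absurd (mem_sitesAbove.1 h) (not_lt.2 (hmin x hx))
      rw [Finset.sum_insert ha, h1, Finset.sum_congr rfl fun x hx => by rw [h2 x hx], ih,
        avg_insert ν ha, avg_sub_siteAvg, sqNorm_eq_add ν a (avg ν s f)]
      ring
  have h := key Finset.univ
  simp only [Finset.univ_inter] at h
  have hu : sqNorm ν (avg ν Finset.univ f) = (∫ ω, f ω ∂(Measure.pi fun _ : ι => ν)) ^ 2 := by
    simp [sqNorm, avg_univ]
  rw [← hu]
  exact h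

/-- Leaving the sites of `N` unaveraged costs only their own increments. When the top-ranked `a` of
`N` is released, Pythagoras at `a` adds a term in which all sites above `a` are still averaged.
Since `E_x` and `E_a` commute, this term is the image of a further-revealed increment at `a` under
the contraction `1 - E_x`. -/
theorem sqNorm_avg_sdiff_le {r : ι → α} (f : (ι → S) → ℝ) (x : ι)
    {N : Finset ι} (hN : N ⊆ sitesAbove r x) :
    sqNorm ν (avg ν (sitesAbove r x \ N) (f - siteAvg ν x f)) ≤
      sqNorm ν (increment ν r f x) + ∑ y ∈ N, sqNorm ν (increment ν r f y) := by
  induction N using Finset.induction_on_max_value r with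
  | empty => simp [increment]
  | insert a s ha hmax ih =>
    obtain ⟨hax, hs⟩ := Finset.insert_subset_iff.1 hN
    specialize ih hs
    set h := f - siteAvg ν x f with hh
    set B := sitesAbove r x \ insert a s with hB
    have haB : a ∉ B := by simp [hB]
    have hB' : sitesAbove r x \ s = insert a B := by
      ext y
      simp only [hB, Finset.mem_sdiff, Finset.mem_insert]
      by_cases hy : y = a
      · subst hy; simp [ha, hax]
      · simp [hy]
    rw [hB', avg_insert ν haB] at ih
    rw [Finset.sum_insert ha, sqNorm_eq_add ν a]
    -- Maximality of the rank of `a` in `N` enters here: nothing above `a` has been released.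
    have hsub : sitesAbove r a ⊆ B := by
      intro y hy
      rw [mem_sitesAbove] at hy hax
      simp only [hB, Finset.mem_sdiff, Finset.mem_insert, mem_sitesAbove, not_or]
      exact ⟨hax.trans hy, fun e => absurd hy (by simp [e]),
        fun e => absurd hy (not_lt.2 (hmax y e))⟩
    have hle : sqNorm ν (avg ν B h - siteAvg ν a (avg ν B h)) ≤
        sqNorm ν (increment ν r f a) := by
      have e : avg ν B h - siteAvg ν a (avg ν B h) =
          avg ν B (f - siteAvg ν a f) - siteAvg ν x (avg ν B (f - siteAvg ν a f)) := by
        have hc := LinearMap.congr_fun (siteAvg_commute (S := S) ν a x).eq (avg ν B f)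
        simp only [Module.End.mul_apply] at hc
        simp only [hh, map_sub, avg_siteAvg, hc]
        abel
      rw [e]
      exact (sqNorm_sub_siteAvg_le ν x _).trans (sqNorm_avg_le_of_subset ν hsub _)
    linarith

/-- The weights come from `2ab ≤ a²/4 + 4b²`. The symmetric weights `2, 2` could not push the gap
above `1/2`; the factor `5/4` on the main term can. -/
theorem sqNorm_add_le (f g : (ι → S) → ℝ) :
    sqNorm ν (f + g) ≤ 5 / 4 * sqNorm ν f + 5 * sqNorm ν g := by
  simp only [sqNorm]
  rw [← integral_const_mul, ← integral_const_mul, ← integral_add .of_finite .of_finite]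
  refine integral_mono .of_finite .of_finite fun ω => ?_
  simp only [Pi.add_apply]
  nlinarith [sq_nonneg (f ω - 4 * g ω)]

/-- Conditional Cauchy-Schwarz over `N`: as `b` depends only on `N`, the average of `b² = b` is the
constant `∫ b`. -/
theorem sqNorm_avg_mul_le {N : Finset ι} {b : (ι → S) → ℝ} (hb : ∀ ω, b ω ^ 2 = b ω)
    (hbN : ∀ i ∉ N, IndepOf i b) (g : (ι → S) → ℝ) :
    sqNorm ν (avg ν N (b * g)) ≤
      (∫ ω, b ω ∂(Measure.pi fun _ : ι => ν)) * sqNorm ν g := by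
  have hb2 : b ^ 2 = b := funext hb
  have h1 : ∀ ω, avg ν N (b ^ 2) ω = ∫ ω, b ω ∂(Measure.pi fun _ : ι => ν) := by
    intro ω
    rw [hb2, ← avg_univ ν b ω, ← Finset.union_compl N, avg_union ν disjoint_compl_right,
      avg_of_indepOf ν (A := Nᶜ) fun i hi => hbN i (Finset.mem_compl.1 hi)]
  calc sqNorm ν (avg ν N (b * g))
      ≤ ∫ ω, (∫ ω, b ω ∂(Measure.pi fun _ : ι => ν)) * avg ν N (g ^ 2) ω
          ∂(Measure.pi fun _ : ι => ν) := by
        refine integral_mono .of_finite .of_finite fun ω => ?_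
        simpa only [h1] using avg_mul_sq_le ν N b g ω
    _ = _ := by
        rw [integral_const_mul, integral_avg]
        rfl

/-- The main estimate at one site: split by the constraint, keep the satisfied part as a Dirichlet
term, and pay `ε` times nearby increments for the rest. -/
theorem sqNorm_increment_le {r : ι → α} (f : (ι → S) → ℝ) (x : ι)
    {N : Finset ι} (hN : N ⊆ sitesAbove r x) {c : (ι → S) → ℝ} (hc : ∀ ω, c ω ^ 2 = c ω)
    (hcN : ∀ i ∉ N, IndepOf i c) {ε : ℝ}
    (hε : ∫ ω, (1 - c ω) ∂(Measure.pi fun _ : ι => ν) ≤ ε) :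
    sqNorm ν (increment ν r f x) ≤
      5 / 4 * ∫ ω, c ω * (f ω - siteAvg ν x f ω) ^ 2 ∂(Measure.pi fun _ : ι => ν) +
        5 * ε * (sqNorm ν (increment ν r f x) + ∑ y ∈ N, sqNorm ν (increment ν r f y)) := by
  set h := f - siteAvg ν x f with hh
  have e : increment ν r f x =
      avg ν (sitesAbove r x) (c * h) + avg ν (sitesAbove r x) ((1 - c) * h) := by
    rw [← map_add, ← add_mul]
    simp [increment, hh]
  have h1 : sqNorm ν (avg ν (sitesAbove r x) (c * h)) ≤
      ∫ ω, c ω * (f ω - siteAvg ν x f ω) ^ 2 ∂(Measure.pi fun _ : ι => ν) := by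
    refine (sqNorm_avg_le ν _ _).trans (le_of_eq ?_)
    refine integral_congr_ae (.of_forall fun ω => ?_)
    simp only [Pi.mul_apply, mul_pow, hc, hh, Pi.sub_apply]
  have hb : ∀ i ∉ N, IndepOf i (1 - c) := fun i hi ω s => by
    simp [hcN i hi ω s]
  -- The factor `1 - c` ignores sites outside `N`, so those can be averaged first, past this factor.
  have e2 : avg ν (sitesAbove r x) ((1 - c) * h) =
      avg ν N ((1 - c) * avg ν (sitesAbove r x \ N) h) := by
    conv_lhs => rw [← Finset.union_sdiff_of_subset hN, avg_union ν Finset.disjoint_sdiff,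
      avg_mul ν fun i hi => hb i (Finset.mem_sdiff.1 hi).2]
  have h2 : sqNorm ν (avg ν (sitesAbove r x) ((1 - c) * h)) ≤
      ε * (sqNorm ν (increment ν r f x) + ∑ y ∈ N, sqNorm ν (increment ν r f y)) := by
    have hpos : 0 ≤ ∫ ω, (1 - c) ω ∂(Measure.pi fun _ : ι => ν) :=
      integral_nonneg fun ω => by
        have := hc ω
        simp only [Pi.zero_apply, Pi.sub_apply, Pi.one_apply]
        nlinarith [sq_nonneg (1 - c ω)]
    rw [e2]
    refine (sqNorm_avg_mul_le ν (fun ω => ?_) hb _).trans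
      (mul_le_mul hε (sqNorm_avg_sdiff_le ν f x hN) (sqNorm_nonneg ν _) (hpos.trans hε))
    have := hc ω
    simp only [Pi.sub_apply, Pi.one_apply]
    linarith
  have h3 := sqNorm_add_le ν (avg ν (sitesAbove r x) (c * h))
    (avg ν (sitesAbove r x) ((1 - c) * h))
  rw [← e] at h3
  linarith

/-- The constrained Poincaré inequality for oriented constraints that are satisfied with high
probability. The sites outside `T` are unconstrained, at the price of the distance of `f` to the
functions of the coordinates in `T`. -/
theorem constrained_poincare {r : ι → α} (hr : Function.Injective r) (T : Finset ι)
    (N : ι → Finset ι) (hN : ∀ x ∈ T, N x ⊆ sitesAbove r x) {K : ℕ}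
    (hK : ∀ y, (Finset.univ.filter fun x => y ∈ N x).card ≤ K) (c : ι → (ι → S) → ℝ)
    (hc : ∀ x ∈ T, ∀ ω, c x ω ^ 2 = c x ω) (hcN : ∀ x ∈ T, ∀ i ∉ N x, IndepOf i (c x)) {ε : ℝ}
    (hε0 : 0 ≤ ε) (hε : ∀ x ∈ T, ∫ ω, (1 - c x ω) ∂(Measure.pi fun _ : ι => ν) ≤ ε)
    (hεK : 5 * ε * (1 + K) ≤ 1 / 8) (f ψ : (ι → S) → ℝ) (hψ : ∀ i ∉ T, IndepOf i ψ) :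
    7 / 8 * (sqNorm ν f - (∫ ω, f ω ∂(Measure.pi fun _ : ι => ν)) ^ 2) ≤
      5 / 4 * ∑ x ∈ T,
        ∫ ω, c x ω * (f ω - siteAvg ν x f ω) ^ 2 ∂(Measure.pi fun _ : ι => ν) +
        sqNorm ν (f - ψ) := by
  set D := fun x => sqNorm ν (increment ν r f x) with hD
  have hD0 : ∀ x, 0 ≤ D x := fun x => sqNorm_nonneg ν _
  have hV := sum_sqNorm_increment ν hr f
  -- Outside `T` the increments of `ψ` vanish, so those of `f` are those of `f - ψ`, whose total is
  -- the variance of `f - ψ`.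
  have hout : ∑ x ∈ Tᶜ, D x ≤ sqNorm ν (f - ψ) := by
    have e : ∀ x ∈ Tᶜ, D x = sqNorm ν (increment ν r (f - ψ) x) := by
      intro x hx
      simp only [hD, increment, map_sub, siteAvg_of_indepOf ν (hψ x (Finset.mem_compl.1 hx))]
      congr 1
      abel
    rw [Finset.sum_congr rfl e]
    refine (Finset.sum_le_sum_of_subset_of_nonneg (Finset.subset_univ _)
      fun x _ _ => sqNorm_nonneg ν _).trans ?_
    rw [sum_sqNorm_increment ν hr]
    have := sq_nonneg (∫ ω, (f - ψ) ω ∂(Measure.pi fun _ : ι => ν))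
    linarith
  -- Double counting: each `y` occurs in at most `K` of the sets `N x`.
  have hcount : ∑ x ∈ T, ∑ y ∈ N x, D y ≤ K * ∑ y, D y := by
    calc ∑ x ∈ T, ∑ y ∈ N x, D y ≤ ∑ x, ∑ y ∈ N x, D y :=
          Finset.sum_le_sum_of_subset_of_nonneg (Finset.subset_univ _)
            fun x _ _ => Finset.sum_nonneg fun y _ => hD0 y
      _ = ∑ y, ∑ x ∈ Finset.univ.filter (fun x => y ∈ N x), D y := by
          refine Finset.sum_comm' fun x y => ?_
          simp
      _ ≤ ∑ y, K * D y := by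
          refine Finset.sum_le_sum fun y _ => ?_
          rw [Finset.sum_const, nsmul_eq_mul]
          exact mul_le_mul_of_nonneg_right (by exact_mod_cast hK y) (hD0 y)
      _ = K * ∑ y, D y := by rw [Finset.mul_sum]
  have hT : ∑ x ∈ T, D x ≤ ∑ y, D y :=
    Finset.sum_le_sum_of_subset_of_nonneg (Finset.subset_univ _) fun x _ _ => hD0 x
  have hin : ∑ x ∈ T, D x ≤ 5 / 4 * ∑ x ∈ T,
      ∫ ω, c x ω * (f ω - siteAvg ν x f ω) ^ 2 ∂(Measure.pi fun _ : ι => ν) +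
      5 * ε * (∑ x ∈ T, D x + ∑ x ∈ T, ∑ y ∈ N x, D y) := by
    rw [← Finset.sum_add_distrib, Finset.mul_sum, Finset.mul_sum, ← Finset.sum_add_distrib]
    exact Finset.sum_le_sum fun x hx =>
      sqNorm_increment_le ν f x (hN x hx) (hc x hx) (hcN x hx) (hε x hx)
  have hsplit : ∑ x, D x = ∑ x ∈ T, D x + ∑ x ∈ Tᶜ, D x := (Finset.sum_add_sum_compl T D).symm
  have hV0 : 0 ≤ ∑ y, D y := Finset.sum_nonneg fun y _ => hD0 y
  have h5 : 5 * ε * (∑ x ∈ T, D x + ∑ x ∈ T, ∑ y ∈ N x, D y) ≤ 1 / 8 * ∑ y, D y := by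
    calc _ ≤ 5 * ε * (∑ y, D y + K * ∑ y, D y) := by gcongr
      _ = 5 * ε * (1 + K) * ∑ y, D y := by ring
      _ ≤ _ := by gcongr
  rw [← hV]
  change 7 / 8 * ∑ x, D x ≤ _
  linarith

end Martingale

/-! ### The `*`-general model in finite volume. -/

section StarModel

variable {d : ℕ}

theorem toLex_lt_of_mem_starOrientedNbhd {x y : Site d} (h : y ∈ starOrientedNbhd x) :
    toLex x < toLex y := by
  refine Pi.toLex_strictMono (lt_of_le_of_ne (fun i => ?_) h.1.symm)
  rcases h.2 i with h | h <;> simp [h]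

/-- A site is encoded by the bits telling where it agrees with `y`. With `e = 1` this counts a
neighbourhood, with `e = -1` the sites whose neighbourhood contains `y`. -/
theorem card_le_of_forall_coord (A : Finset (Site d)) (y : Site d) (e : Fin d → ℤ)
    (hA : ∀ x ∈ A, ∀ i, x i = y i ∨ x i = y i + e i) : A.card ≤ 2 ^ d := by
  have : A.card ≤ (Finset.univ : Finset (Fin d → Bool)).card := by
    refine Finset.card_le_card_of_injOn (fun x i => decide (x i = y i)) (by simp) ?_
    intro x hx x' hx' h
    funext i
    have hi := congrFun h i
    simp only [decide_eq_decide] at hi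
    rcases hA x hx i with h1 | h1 <;> rcases hA x' hx' i with h2 | h2
    · rw [h1, h2]
    · rw [h1, hi.1 h1]
    · rw [h2, hi.2 h2]
    · rw [h1, h2]
  simpa using this

variable {S : Type*}

theorem constraint_star_of_forall {G : Set S} {x : Site d} {ω : Site d → S}
    (h : ∀ y ∈ starOrientedNbhd x, ω y ∈ G) : constraint starInfluence G x ω = 1 :=
  if_pos ⟨_, rfl, h⟩

theorem constraint_star_of_not_forall {G : Set S} {x : Site d} {ω : Site d → S}
    (h : ¬ ∀ y ∈ starOrientedNbhd x, ω y ∈ G) : constraint starInfluence G x ω = 0 :=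
  if_neg fun ⟨_, hA, h'⟩ => h (by rwa [Set.mem_singleton_iff.1 hA] at h')

theorem constraint_sq (C : Site d → Set (Set (Site d))) (G : Set S) (x : Site d)
    (ω : Site d → S) : constraint C G x ω ^ 2 = constraint C G x ω := by
  rw [constraint]; split_ifs <;> simp

theorem constraint_nonneg (C : Site d → Set (Set (Site d))) (G : Set S) (x : Site d)
    (ω : Site d → S) : 0 ≤ constraint C G x ω := by
  rw [constraint]; split_ifs <;> simp

theorem constraint_le_one (C : Site d → Set (Set (Site d))) (G : Set S) (x : Site d)
    (ω : Site d → S) : constraint C G x ω ≤ 1 := by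
  rw [constraint]; split_ifs <;> simp

theorem constraint_star_congr {G : Set S} {x : Site d} {ω η : Site d → S}
    (h : ∀ y ∈ starOrientedNbhd x, ω y ∈ G ↔ η y ∈ G) :
    constraint starInfluence G x ω = constraint starInfluence G x η := by
  by_cases hω : ∀ y ∈ starOrientedNbhd x, ω y ∈ G
  · rw [constraint_star_of_forall hω, constraint_star_of_forall fun y hy => (h y hy).1 (hω y hy)]
  · rw [constraint_star_of_not_forall hω,
      constraint_star_of_not_forall fun hη => hω fun y hy => (h y hy).2 (hη y hy)]

theorem glue_of_mem {Λ : Finset (Site d)} (ω : Λ → S) (τ : Site d → S) {y : Site d}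
    (h : y ∈ Λ) : glue Λ ω τ y = ω ⟨y, h⟩ := dif_pos h

theorem glue_of_notMem {Λ : Finset (Site d)} (ω : Λ → S) (τ : Site d → S) {y : Site d}
    (h : y ∉ Λ) : glue Λ ω τ y = τ y := dif_neg h

open Classical in
/-- The sites of `Λ` in the `*`-oriented neighbourhood of `x`. -/
noncomputable def nbhdIn (Λ : Finset (Site d)) (x : Λ) : Finset Λ :=
  Finset.univ.filter fun y => (y : Site d) ∈ starOrientedNbhd (x : Site d)

theorem mem_nbhdIn {Λ : Finset (Site d)} {x y : Λ} :
    y ∈ nbhdIn Λ x ↔ (y : Site d) ∈ starOrientedNbhd (x : Site d) := by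
  simp [nbhdIn]

theorem card_nbhdIn_le {Λ : Finset (Site d)} (x : Λ) : (nbhdIn Λ x).card ≤ 2 ^ d := by
  rw [← Finset.card_map (Function.Embedding.subtype _)]
  refine card_le_of_forall_coord _ (x : Site d) (fun _ => 1) fun y hy i => ?_
  simp only [Finset.mem_map, mem_nbhdIn, Function.Embedding.subtype_apply] at hy
  obtain ⟨y, hy, rfl⟩ := hy
  exact hy.2 i

theorem card_filter_mem_nbhdIn_le {Λ : Finset (Site d)} (y : Λ) :
    (Finset.univ.filter fun x => y ∈ nbhdIn Λ x).card ≤ 2 ^ d := by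
  rw [← Finset.card_map (Function.Embedding.subtype _)]
  refine card_le_of_forall_coord _ (y : Site d) (fun _ => -1) fun x hx i => ?_
  simp only [Finset.mem_map, Finset.mem_filter, Finset.mem_univ, true_and, mem_nbhdIn,
    Function.Embedding.subtype_apply] at hx
  obtain ⟨x, hx, rfl⟩ := hx
  rcases hx.2 i with h | h
  · exact Or.inl h.symm
  · right; omega

theorem indepOf_constraint_glue {Λ : Finset (Site d)} (G : Set S) (τ : Site d → S) (x : Λ)
    {i : Λ} (hi : i ∉ nbhdIn Λ x) :
    IndepOf i fun ω : Λ → S => constraint starInfluence G (x : Site d) (glue Λ ω τ) := by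
  intro ω s
  refine constraint_star_congr fun y hy => ?_
  by_cases hyΛ : y ∈ Λ
  · have : (⟨y, hyΛ⟩ : Λ) ≠ i := by
      rintro rfl
      exact hi (mem_nbhdIn.2 hy)
    rw [glue_of_mem _ _ hyΛ, glue_of_mem _ _ hyΛ, Function.update_of_ne this]
  · rw [glue_of_notMem _ _ hyΛ, glue_of_notMem _ _ hyΛ]

variable [Finite S] [MeasurableSpace S] [MeasurableSingletonClass S] (ν : Measure S)
  [IsProbabilityMeasure ν]

/-- Union bound: outside `Λ` the neighbours of `x` are good, so a violated constraint forces a bad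
site among at most `2^d` neighbours inside. -/
theorem integral_one_sub_constraint_le {Λ : Finset (Site d)} (G : Set S) {τ : Site d → S} (x : Λ)
    (hτ : ∀ y ∈ starOrientedNbhd (x : Site d), y ∉ Λ → τ y ∈ G) :
    ∫ ω, (1 - constraint starInfluence G (x : Site d) (glue Λ ω τ))
      ∂(Measure.pi fun _ : Λ => ν) ≤ 2 ^ d * (1 - ν.real G) := by
  have hle : ∀ ω : Λ → S, 1 - constraint starInfluence G (x : Site d) (glue Λ ω τ) ≤
      ∑ y ∈ nbhdIn Λ x, Gᶜ.indicator (fun _ => (1 : ℝ)) (ω y) := by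
    intro ω
    have h0 : ∀ y ∈ nbhdIn Λ x, 0 ≤ Gᶜ.indicator (fun _ => (1 : ℝ)) (ω y) :=
      fun y _ => Set.indicator_nonneg (fun _ _ => zero_le_one) _
    by_cases h : ∀ y ∈ starOrientedNbhd (x : Site d), glue Λ ω τ y ∈ G
    · rw [constraint_star_of_forall h, sub_self]
      exact Finset.sum_nonneg h0
    · rw [constraint_star_of_not_forall h, sub_zero]
      push Not at h
      obtain ⟨y, hy, hyG⟩ := h
      have hyΛ : y ∈ Λ := by
        by_contra hn
        rw [glue_of_notMem _ _ hn] at hyG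
        exact hyG (hτ y hy hn)
      rw [glue_of_mem _ _ hyΛ] at hyG
      refine le_trans (le_of_eq ?_)
        (Finset.single_le_sum h0 (mem_nbhdIn.2 hy : (⟨y, hyΛ⟩ : Λ) ∈ nbhdIn Λ x))
      rw [Set.indicator_of_mem (by exact hyG)]
  have hone : ∀ y : Λ, ∫ ω, Gᶜ.indicator (fun _ => (1 : ℝ)) (ω y)
      ∂(Measure.pi fun _ : Λ => ν) = 1 - ν.real G := by
    intro y
    have h := measurePreserving_eval (fun _ : Λ => ν) y
    have h2 := integral_map (μ := Measure.pi fun _ : Λ => ν)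
      (f := Gᶜ.indicator fun _ => (1 : ℝ)) h.measurable.aemeasurable
      .of_discrete
    rw [h.map_eq] at h2
    rw [← probReal_compl_eq_one_sub (.of_discrete)]
    rw [← integral_indicator_one (.of_discrete)]
    exact h2.symm
  calc _ ≤ ∫ ω, ∑ y ∈ nbhdIn Λ x, Gᶜ.indicator (fun _ => (1 : ℝ)) (ω y)
        ∂(Measure.pi fun _ : Λ => ν) := integral_mono .of_finite .of_finite hle
    _ = (nbhdIn Λ x).card * (1 - ν.real G) := by
        rw [integral_finsetSum _ fun _ _ => .of_finite]
        rw [Finset.sum_congr rfl fun y _ => hone y, Finset.sum_const, nsmul_eq_mul]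
    _ ≤ _ := by
        refine mul_le_mul_of_nonneg_right (by exact_mod_cast card_nbhdIn_le x) ?_
        linarith [measureReal_le_one (μ := ν) (s := G)]

theorem evariance_update_eq {ι : Type*} [DecidableEq ι] (f : (ι → S) → ℝ) (x : ι) (ω : ι → S) :
    evariance (fun s => f (Function.update ω x s)) ν =
      ENNReal.ofReal (siteAvg ν x ((f - siteAvg ν x f) ^ 2) ω) := by
  rw [← ofReal_variance (.of_discrete), variance_eq_integral (.of_discrete)]
  congr 1
  simp [siteAvg_apply]

/-- As `c` does not see the coordinate `x`, averaging over it passes through `c` and turns the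
squared deviation into the local variance. -/
theorem lintegral_mul_evariance_eq {ι : Type*} [Fintype ι] [DecidableEq ι] (x : ι)
    {c : (ι → S) → ℝ} (hc0 : 0 ≤ c) (hc : IndepOf x c) (f : (ι → S) → ℝ) :
    ∫⁻ ω, ENNReal.ofReal (c ω) * evariance (fun s => f (Function.update ω x s)) ν
        ∂(Measure.pi fun _ : ι => ν) =
      ENNReal.ofReal (∫ ω, c ω * (f ω - siteAvg ν x f ω) ^ 2 ∂(Measure.pi fun _ : ι => ν)) := by
  have h : ∫ ω, c ω * (f ω - siteAvg ν x f ω) ^ 2 ∂(Measure.pi fun _ : ι => ν) =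
      ∫ ω, c ω * siteAvg ν x ((f - siteAvg ν x f) ^ 2) ω ∂(Measure.pi fun _ : ι => ν) := by
    have := integral_siteAvg ν x (c * (f - siteAvg ν x f) ^ 2)
    rw [siteAvg_mul ν hc] at this
    exact this.symm
  rw [h, ofReal_integral_eq_lintegral_ofReal .of_finite]
  · refine lintegral_congr fun ω => ?_
    rw [evariance_update_eq, ENNReal.ofReal_mul (hc0 ω)]
  · exact .of_forall fun ω => mul_nonneg (hc0 ω)
      (siteAvg_nonneg ν x (fun _ => sq_nonneg _) ω)

/-- The finite-volume Poincaré inequality of the `*`-general model, with the constrained resamplings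
restricted to the sites in `T`. -/
theorem evariance_le_of_good_boundary {Λ : Finset (Site d)} {G : Set S} {τ : Site d → S}
    (hq : 1 - 1 / (40 * 2 ^ d * (1 + 2 ^ d)) ≤ ν.real G) (T : Finset Λ)
    (hτ : ∀ x ∈ T, ∀ y ∈ starOrientedNbhd (x : Site d), y ∉ Λ → τ y ∈ G)
    (f ψ : (Λ → S) → ℝ) (hψ : ∀ i ∉ T, IndepOf i ψ) :
    evariance f (Measure.pi fun _ : Λ => ν) ≤
      ENNReal.ofReal (10 / 7) * ∑ x ∈ T, ∫⁻ ω,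
        ENNReal.ofReal (constraint starInfluence G (x : Site d) (glue Λ ω τ)) *
          evariance (fun s => f (Function.update ω x s)) ν ∂(Measure.pi fun _ : Λ => ν) +
      ENNReal.ofReal (8 / 7) *
        ∫⁻ ω, ENNReal.ofReal ((f ω - ψ ω) ^ 2) ∂(Measure.pi fun _ : Λ => ν) := by
  have hq1 : ν.real G ≤ 1 := measureReal_le_one
  have hx : ∀ x : Λ, x ∉ nbhdIn Λ x := fun x h => (mem_nbhdIn.1 h).1 rfl
  have hmain := constrained_poincare ν (r := fun x : Λ => toLex (x : Site d))
    (fun x y h => Subtype.ext (toLex.injective h)) T (nbhdIn Λ)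
    (fun x _ y hy => mem_sitesAbove.2 (toLex_lt_of_mem_starOrientedNbhd (mem_nbhdIn.1 hy)))
    card_filter_mem_nbhdIn_le
    (fun x ω => constraint starInfluence G (x : Site d) (glue Λ ω τ))
    (fun x _ ω => constraint_sq _ _ _ _) (fun x _ i hi => indepOf_constraint_glue G τ x hi)
    (ε := 2 ^ d * (1 - ν.real G)) (mul_nonneg (by positivity) (by linarith))
    (fun x hx => integral_one_sub_constraint_le ν G x (hτ x hx))
    -- The threshold on `q` is chosen so that `5 ε (1 + 2^d) ≤ 1/8` with `ε = 2^d (1 - q)`.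
    (by
      have hpos : (0 : ℝ) < 2 ^ d := by positivity
      push_cast
      have h1 : 1 - ν.real G ≤ 1 / (40 * 2 ^ d * (1 + 2 ^ d)) := by linarith
      calc 5 * (2 ^ d * (1 - ν.real G)) * (1 + 2 ^ d)
          ≤ 5 * (2 ^ d * (1 / (40 * 2 ^ d * (1 + 2 ^ d)))) * (1 + 2 ^ d) := by gcongr
        _ = 1 / 8 := by field_simp; norm_num)
    f ψ hψ
  have e1 : evariance f (Measure.pi fun _ : Λ => ν) = ENNReal.ofReal (sqNorm ν f -
      (∫ ω, f ω ∂(Measure.pi fun _ : Λ => ν)) ^ 2) := by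
    rw [← ofReal_variance .of_discrete, variance_eq_sub .of_discrete]
    rfl
  have e2 : ∫⁻ ω, ENNReal.ofReal ((f ω - ψ ω) ^ 2) ∂(Measure.pi fun _ : Λ => ν) =
      ENNReal.ofReal (sqNorm ν (f - ψ)) := by
    rw [sqNorm, ofReal_integral_eq_lintegral_ofReal .of_finite (.of_forall fun _ => sq_nonneg _)]
    rfl
  have hnn : ∀ x ∈ T, 0 ≤ ∫ ω, constraint starInfluence G (x : Site d) (glue Λ ω τ) *
      (f ω - siteAvg ν x f ω) ^ 2 ∂(Measure.pi fun _ : Λ => ν) := fun x _ =>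
    integral_nonneg fun ω => mul_nonneg (constraint_nonneg _ _ _ _) (sq_nonneg _)
  rw [Finset.sum_congr rfl fun (x : Λ) _ => lintegral_mul_evariance_eq ν x
    (c := fun ω : Λ → S => constraint starInfluence G (x : Site d) (glue Λ ω τ))
    (fun ω => constraint_nonneg starInfluence G (x : Site d) (glue Λ ω τ))
    (indepOf_constraint_glue G τ x (hx x)) f, ← ENNReal.ofReal_sum_of_nonneg hnn, e1, e2,
    ← ENNReal.ofReal_mul (by norm_num), ← ENNReal.ofReal_mul (by norm_num),
    ← ENNReal.ofReal_add (mul_nonneg (by norm_num) (Finset.sum_nonneg hnn))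
      (mul_nonneg (by norm_num) (sqNorm_nonneg ν _))]
  refine ENNReal.ofReal_le_ofReal ?_
  linarith

theorem le_finiteGap (hν : ∀ s, 0 < ν {s}) {G : Set S}
    (hq : 1 - 1 / (40 * 2 ^ d * (1 + 2 ^ d)) ≤ ν.real G) (Λ : Finset (Site d)) {τ : Site d → S}
    (hτ : ∀ y ∈ starOrientedBoundary Λ, τ y ∈ G) :
    ENNReal.ofReal (7 / 10) ≤ finiteGap starInfluence G ν Λ τ := by
  refine le_iInf₂ fun f hf => ?_
  -- With every site resampled one may take `ψ = f`, and the distance term disappears.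
  have h := evariance_le_of_good_boundary ν hq (Finset.univ : Finset Λ) (τ := τ)
    (fun x _ y hy hyΛ => hτ y ⟨Set.mem_biUnion x.2 hy, hyΛ⟩) f f (by simp)
  simp only [sub_self, ne_eq, OfNat.ofNat_ne_zero, not_false_eq_true, zero_pow,
    ENNReal.ofReal_zero, lintegral_zero, mul_zero, add_zero] at h
  have hfin : evariance f (Measure.pi fun _ : Λ => ν) ≠ ∞ := evariance_ne_top .of_discrete
  -- All atoms of `ν` have positive mass, so almost everywhere constant means constant.
  have hne : evariance f (Measure.pi fun _ : Λ => ν) ≠ 0 := by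
    rw [ne_eq, evariance_eq_zero_iff (Measurable.of_discrete).aemeasurable]
    intro hae
    refine hf ⟨∫ η, f η ∂(Measure.pi fun _ : Λ => ν), fun ω => ?_⟩
    by_contra hω
    have h0 : (Measure.pi fun _ : Λ => ν) {ω} = 0 :=
      measure_mono_null (by simpa using hω) (ae_iff.1 hae)
    rw [Measure.pi_singleton] at h0
    exact (Finset.prod_ne_zero_iff.2 fun i _ => (hν (ω i)).ne') h0
  rw [ENNReal.le_div_iff_mul_le (.inl hne) (.inl hfin)]
  calc _ ≤ ENNReal.ofReal (7 / 10) * (ENNReal.ofReal (10 / 7) *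
        finiteDirichlet starInfluence G ν Λ τ f) := by gcongr; exact h
    _ = _ := by
        rw [← mul_assoc, ← ENNReal.ofReal_mul (by norm_num)]
        norm_num

end StarModel

/-! ### Passage to infinite volume. -/

section InfiniteVolumePoincare

theorem ofReal_add_sq_le (a b : ℝ) : ENNReal.ofReal ((a + b) ^ 2) ≤
    2 * ENNReal.ofReal (a ^ 2) + 2 * ENNReal.ofReal (b ^ 2) := by
  have h2 : (2 : ℝ≥0∞) = ENNReal.ofReal 2 := by simp
  rw [h2, ← ENNReal.ofReal_mul zero_le_two, ← ENNReal.ofReal_mul zero_le_two,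
    ← ENNReal.ofReal_add (by positivity) (by positivity)]
  exact ENNReal.ofReal_le_ofReal (by nlinarith [sq_nonneg (a - b)])

theorem evariance_le_two_mul_add {Ω : Type*} [MeasurableSpace Ω] {P : Measure Ω}
    [IsProbabilityMeasure P] {u v : Ω → ℝ} (hu : MemLp u 2 P) (hv : MemLp v 2 P) :
    evariance u P ≤ 2 * evariance v P + 2 * ∫⁻ ω, ENNReal.ofReal ((u ω - v ω) ^ 2) ∂P := by
  have hw : MemLp (u - v) 2 P := hu.sub hv
  have hint : ∫ ω, u ω ∂P = ∫ ω, v ω ∂P + ∫ ω, (u - v) ω ∂P := by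
    rw [← integral_add (hv.integrable one_le_two) (hw.integrable one_le_two)]
    simp
  have hle : evariance (u - v) P ≤ ∫⁻ ω, ENNReal.ofReal ((u ω - v ω) ^ 2) ∂P := by
    rw [← hw.ofReal_variance_eq]
    have := variance_le_expectation_sq (X := u - v) hw.1
    refine (ENNReal.ofReal_le_ofReal this).trans (le_of_eq ?_)
    exact ofReal_integral_eq_lintegral_ofReal hw.integrable_sq (.of_forall fun _ => sq_nonneg _)
  calc evariance u P ≤ ∫⁻ ω, (2 * ENNReal.ofReal ((v ω - ∫ η, v η ∂P) ^ 2) +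
        2 * ENNReal.ofReal (((u - v) ω - ∫ η, (u - v) η ∂P) ^ 2)) ∂P := by
        rw [evariance_eq_lintegral_ofReal]
        refine lintegral_mono fun ω => ?_
        refine le_trans (le_of_eq ?_) (ofReal_add_sq_le _ _)
        rw [hint]
        congr 2
        simp only [Pi.sub_apply]
        ring
    _ = 2 * evariance v P + 2 * evariance (u - v) P := by
        rw [lintegral_add_left', lintegral_const_mul' _ _ (by simp),
          lintegral_const_mul' _ _ (by simp), evariance_eq_lintegral_ofReal,
          evariance_eq_lintegral_ofReal]
        exact (((hv.1.aemeasurable.sub_const _).pow_const 2).ennreal_ofReal).const_mul _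
    _ ≤ _ := by gcongr

variable {d : ℕ} {S : Type*}

theorem finite_starOrientedNbhd (x : Site d) : (starOrientedNbhd x).Finite := by
  refine (Set.finite_Icc x (x + 1)).subset fun y hy => ⟨fun i => ?_, fun i => ?_⟩ <;>
  rcases hy.2 i with h | h <;> simp [h]

theorem glue_restrict_of_mem {Λ : Finset (Site d)} (ω τ : Site d → S) {y : Site d}
    (h : y ∈ Λ) : glue Λ (Λ.restrict ω) τ y = ω y := by
  rw [glue_of_mem _ _ h]; rfl

theorem apply_glue_restrict {Λ : Finset (Site d)} {φ : (Site d → S) → ℝ}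
    (hφ : DependsOn φ (Λ : Set (Site d))) (ω τ : Site d → S) :
    φ (glue Λ (Λ.restrict ω) τ) = φ ω :=
  hφ fun _ hy => glue_restrict_of_mem ω τ hy

theorem update_restrict {Λ : Finset (Site d)} (ω : Site d → S) (x : Λ) (s : S) :
    Function.update (Λ.restrict ω) x s = Λ.restrict (Function.update ω x s) := by
  funext y
  by_cases h : y = x
  · subst h; simp
  · have : (y : Site d) ≠ x := fun e => h (Subtype.ext e)
    simp [h, this]

variable [Finite S] [MeasurableSpace S] [MeasurableSingletonClass S] (ν : Measure S)
  [IsProbabilityMeasure ν]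

instance : IsProbabilityMeasure (productMeasure d ν) := by
  unfold productMeasure; infer_instance

theorem measurePreserving_restrict (Λ : Finset (Site d)) :
    MeasurePreserving Λ.restrict (productMeasure d ν) (Measure.pi fun _ : Λ => ν) :=
  ⟨Finset.measurable_restrict Λ, Measure.infinitePi_map_restrict _⟩

theorem measurable_and_memLp_of_dependsOn {Λ : Finset (Site d)} {φ : (Site d → S) → ℝ}
    (hφ : DependsOn φ (Λ : Set (Site d))) : Measurable φ ∧ MemLp φ 2 (productMeasure d ν) := by
  obtain ⟨s⟩ := ν.nonempty_of_neZero
  set φ' : (Λ → S) → ℝ := fun η => φ (glue Λ η fun _ => s)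
  have e : φ = φ' ∘ Λ.restrict := funext fun ω => (apply_glue_restrict hφ ω _).symm
  have hm : Measurable φ' := .of_discrete
  have hL : MemLp φ' 2 (Measure.pi fun _ : Λ => ν) := .of_discrete
  rw [e]
  exact ⟨hm.comp (measurePreserving_restrict ν Λ).measurable,
    hL.comp_measurePreserving (measurePreserving_restrict ν Λ)⟩

/-- The Poincaré inequality for local functions, with the resamplings restricted to `T`. -/
theorem evariance_le_of_dependsOn {G : Set S}
    (hq : 1 - 1 / (40 * 2 ^ d * (1 + 2 ^ d)) ≤ ν.real G) {T : Finset (Site d)}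
    {φ ψ : (Site d → S) → ℝ} (hφ : IsLocal φ) (hψ : DependsOn ψ (T : Set (Site d))) :
    evariance φ (productMeasure d ν) ≤
      ENNReal.ofReal (10 / 7) * ∑ x ∈ T, ∫⁻ ω, ENNReal.ofReal (constraint starInfluence G x ω) *
          evariance (fun s => φ (Function.update ω x s)) ν ∂(productMeasure d ν) +
      ENNReal.ofReal (8 / 7) *
        ∫⁻ ω, ENNReal.ofReal ((φ ω - ψ ω) ^ 2) ∂(productMeasure d ν) := by
  classical
  obtain ⟨s⟩ := ν.nonempty_of_neZero
  obtain ⟨Λ₀, hΛ₀⟩ := hφ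
  -- Adding the neighbourhoods of `T` makes every constraint at a site of `T` a function of the
  -- configuration in `Λ`. The boundary condition is then irrelevant and may be any constant, good
  -- or not.
  set Λ : Finset (Site d) :=
    Λ₀ ∪ T ∪ T.biUnion fun x => (finite_starOrientedNbhd x).toFinset with hΛ
  have hTΛ : ∀ x ∈ T, x ∈ Λ := fun x hx => by simp [hΛ, hx]
  have hNΛ : ∀ x ∈ T, ∀ y ∈ starOrientedNbhd x, y ∈ Λ := fun x hx y hy => by
    simp only [hΛ, Finset.mem_union, Finset.mem_biUnion, Set.Finite.mem_toFinset]
    exact Or.inr ⟨x, hx, hy⟩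
  have hφΛ : DependsOn φ (Λ : Set (Site d)) := hΛ₀.mono fun y hy => by
    simp only [hΛ, Finset.coe_union]
    exact Or.inl (Or.inl hy)
  have hψΛ : DependsOn ψ (Λ : Set (Site d)) := hψ.mono fun y hy => hTΛ y hy
  set τ : Site d → S := fun _ => s
  set φ' : (Λ → S) → ℝ := fun η => φ (glue Λ η τ) with hφ'
  set ψ' : (Λ → S) → ℝ := fun η => ψ (glue Λ η τ) with hψ'
  have eφ : ∀ ω, φ' (Λ.restrict ω) = φ ω := fun ω => apply_glue_restrict hφΛ ω τ
  have eψ : ∀ ω, ψ' (Λ.restrict ω) = ψ ω := fun ω => apply_glue_restrict hψΛ ω τ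
  have hmp := measurePreserving_restrict ν Λ
  have hindep : ∀ i ∉ T.subtype (· ∈ Λ), IndepOf i ψ' := by
    intro i hi ω s'
    refine hψ fun y hy => ?_
    rw [glue_of_mem _ _ (hTΛ y hy), glue_of_mem _ _ (hTΛ y hy), Function.update_of_ne]
    rintro rfl
    exact hi (Finset.mem_subtype.2 hy)
  have h := evariance_le_of_good_boundary ν hq (T.subtype (· ∈ Λ)) (τ := τ)
    (fun x hx y hy hyΛ => absurd (hNΛ x (Finset.mem_subtype.1 hx) y hy) hyΛ) φ' ψ' hindep
  have e1 : evariance φ (productMeasure d ν) = evariance φ' (Measure.pi fun _ : Λ => ν) := by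
    have hi : ∫ ω, φ ω ∂(productMeasure d ν) = ∫ η, φ' η ∂(Measure.pi fun _ : Λ => ν) := by
      rw [← hmp.map_eq, integral_map hmp.measurable.aemeasurable .of_discrete]
      simp only [eφ]
    rw [evariance, evariance, ← hmp.lintegral_comp .of_discrete, hi]
    simp only [eφ]
  have e2 : ∫⁻ ω, ENNReal.ofReal ((φ ω - ψ ω) ^ 2) ∂(productMeasure d ν) =
      ∫⁻ η, ENNReal.ofReal ((φ' η - ψ' η) ^ 2) ∂(Measure.pi fun _ : Λ => ν) := by
    rw [← hmp.lintegral_comp .of_discrete]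
    simp only [eφ, eψ]
  have e3 : ∀ x ∈ T.subtype (· ∈ Λ), ∫⁻ η,
        ENNReal.ofReal (constraint starInfluence G (x : Site d) (glue Λ η τ)) *
          evariance (fun s => φ' (Function.update η x s)) ν ∂(Measure.pi fun _ : Λ => ν) =
      ∫⁻ ω, ENNReal.ofReal (constraint starInfluence G (x : Site d) ω) *
          evariance (fun s => φ (Function.update ω x s)) ν ∂(productMeasure d ν) := by
    intro x hx
    rw [← hmp.lintegral_comp .of_discrete]
    refine lintegral_congr fun ω => ?_
    simp only [update_restrict, eφ]
    rw [constraint_star_congr fun y hy => by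
      rw [glue_restrict_of_mem ω τ (hNΛ x (Finset.mem_subtype.1 hx) y hy)]]
  rw [Finset.sum_congr rfl e3, Finset.sum_subtype_of_mem
    (fun x : Site d => ∫⁻ ω, ENNReal.ofReal (constraint starInfluence G x ω) *
      evariance (fun s => φ (Function.update ω x s)) ν ∂(productMeasure d ν)) hTΛ] at h
  rw [e1, e2]
  exact h

/-- Continuity in `L²` of a single Dirichlet term: in the error the constraint is bounded by `1`,
and resampling preserves the measure. -/
theorem lintegral_constraint_evariance_le (C : Site d → Set (Set (Site d))) (G : Set S)
    (x : Site d) {u v : (Site d → S) → ℝ} (hu : Measurable u) (hv : Measurable v) :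
    ∫⁻ ω, ENNReal.ofReal (constraint C G x ω) *
        evariance (fun s => u (Function.update ω x s)) ν ∂(productMeasure d ν) ≤
      2 * ∫⁻ ω, ENNReal.ofReal (constraint C G x ω) *
        evariance (fun s => v (Function.update ω x s)) ν ∂(productMeasure d ν) +
      2 * ∫⁻ ω, ENNReal.ofReal ((u ω - v ω) ^ 2) ∂(productMeasure d ν) := by
  have hg : Measurable fun ω => ENNReal.ofReal ((u ω - v ω) ^ 2) := by fun_prop
  have hm : Measurable fun ω => ∫⁻ s, ENNReal.ofReal ((u (Function.update ω x s) -
      v (Function.update ω x s)) ^ 2) ∂ν :=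
    (hg.comp (measurePreserving_update ν x).measurable).lintegral_prod_right'
  calc _ ≤ ∫⁻ ω, (2 * (ENNReal.ofReal (constraint C G x ω) *
          evariance (fun s => v (Function.update ω x s)) ν) +
        2 * ∫⁻ s, ENNReal.ofReal ((u (Function.update ω x s) -
          v (Function.update ω x s)) ^ 2) ∂ν) ∂(productMeasure d ν) := by
        refine lintegral_mono fun ω => ?_
        have h1 : ENNReal.ofReal (constraint C G x ω) ≤ 1 := by
          simpa using constraint_le_one C G x ω
        refine (mul_le_mul_right (evariance_le_two_mul_add
          (v := fun s => v (Function.update ω x s)) .of_discrete .of_discrete) _).trans ?_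
        rw [mul_add, mul_left_comm]
        exact add_le_add le_rfl (mul_le_of_le_one_left' h1)
    _ = _ := by
        rw [lintegral_add_right _ (hm.const_mul _), lintegral_const_mul' _ _ (by simp),
          lintegral_const_mul' _ _ (by simp)]
        congr 2
        exact lintegral_lintegral_update ν x hg

/-- Closeness in the graph norm controls the first component; the second is not needed. -/
theorem exists_isLocal_near (C : Site d → Set (Set (Site d))) (G : Set S)
    {f : Lp ℝ 2 (productMeasure d ν)} (hf : f ∈ (generator C G ν).domain) {ε : ℝ≥0∞}
    (hε : 0 < ε) :
    ∃ φ, IsLocal φ ∧ ∫⁻ ω, ENNReal.ofReal ((f ω - φ ω) ^ 2) ∂(productMeasure d ν) ≤ ε := by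
  rw [generator, Submodule.toLinearPMap_domain, Submodule.mem_map] at hf
  obtain ⟨p, hp, rfl⟩ := hf
  obtain ⟨p', ⟨φ, hφ, h1, -⟩, hd⟩ := EMetric.mem_closure_iff.1 hp (ε ^ (1 / 2 : ℝ))
    (ENNReal.rpow_pos_of_nonneg hε (by norm_num))
  refine ⟨φ, hφ, ?_⟩
  have hd1 : edist p.1 p'.1 ≤ ε ^ (1 / 2 : ℝ) := (le_max_left _ _).trans hd.le
  rw [Lp.edist_def, eLpNorm_eq_lintegral_rpow_enorm_toReal (by simp) (by simp)] at hd1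
  have h2 := (ENNReal.rpow_le_rpow_iff (z := (1 / 2 : ℝ)) (by norm_num)).1
    (by simpa using hd1)
  refine le_trans (le_of_eq (lintegral_congr_ae ?_)) h2
  filter_upwards [h1] with ω hω
  simp [← hω, ← enorm_pow, Real.enorm_of_nonneg (sq_nonneg _)]

/-- The Poincaré inequality on the domain of the generator. -/
theorem evariance_le_dirichlet {G : Set S}
    (hq : 1 - 1 / (40 * 2 ^ d * (1 + 2 ^ d)) ≤ ν.real G)
    {f : Lp ℝ 2 (productMeasure d ν)} (hf : f ∈ (generator starInfluence G ν).domain) :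
    evariance f (productMeasure d ν) ≤ 8 * dirichlet starInfluence G ν f := by
  set F : (Site d → S) → ℝ := ⇑f
  have hFm : Measurable F := (Lp.stronglyMeasurable f).measurable
  have key : ∀ ε : ℝ≥0∞, 0 < ε →
      evariance F (productMeasure d ν) ≤ 8 * dirichlet starInfluence G ν F + 26 * ε := by
    intro ε hε
    -- Two approximations are needed: `ψ` fixes `T`, and only then is `φ` taken so close to `f` that
    -- the errors of all `T.card` Dirichlet terms sum to `O(ε)`. The support of `φ` may exceed `T`.
    obtain ⟨ψ, ⟨T, hψ⟩, hψε⟩ := exists_isLocal_near ν _ _ hf hε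
    obtain ⟨φ, hφ, hφε⟩ := exists_isLocal_near ν _ _ hf (ε := ε / (T.card + 1))
      (ENNReal.div_pos hε.ne' (by finiteness))
    have hφε' : ∫⁻ ω, ENNReal.ofReal ((F ω - φ ω) ^ 2) ∂(productMeasure d ν) ≤ ε :=
      hφε.trans (ENNReal.div_le_of_le_mul (le_mul_of_one_le_right' (by simp)))
    obtain ⟨hφm, hφL⟩ : Measurable φ ∧ MemLp φ 2 (productMeasure d ν) := by
      obtain ⟨Λ, hΛ⟩ := hφ; exact measurable_and_memLp_of_dependsOn ν hΛ
    have hsymm : ∀ ω, ENNReal.ofReal ((φ ω - F ω) ^ 2) = ENNReal.ofReal ((F ω - φ ω) ^ 2) :=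
      fun ω => by rw [← neg_sub, neg_sq]
    have hlocal := evariance_le_of_dependsOn ν hq hφ hψ
    have hsum : ∑ x ∈ T, ∫⁻ ω, ENNReal.ofReal (constraint starInfluence G x ω) *
        evariance (fun s => φ (Function.update ω x s)) ν ∂(productMeasure d ν) ≤
        2 * dirichlet starInfluence G ν F + 2 * ε := by
      calc _ ≤ ∑ x ∈ T, (2 * ∫⁻ ω, ENNReal.ofReal (constraint starInfluence G x ω) *
            evariance (fun s => F (Function.update ω x s)) ν ∂(productMeasure d ν) +
            2 * (ε / (T.card + 1))) := by
            refine Finset.sum_le_sum fun x _ => ?_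
            refine (lintegral_constraint_evariance_le ν _ G x hφm hFm).trans ?_
            simp only [hsymm]
            gcongr
        _ = 2 * ∑ x ∈ T, ∫⁻ ω, ENNReal.ofReal (constraint starInfluence G x ω) *
            evariance (fun s => F (Function.update ω x s)) ν ∂(productMeasure d ν) +
            2 * (T.card * (ε / (T.card + 1))) := by
            rw [Finset.sum_add_distrib, ← Finset.mul_sum, Finset.sum_const, nsmul_eq_mul]
            ring
        _ ≤ _ := by
            gcongr
            · exact ENNReal.sum_le_tsum T
            · calc (T.card : ℝ≥0∞) * (ε / (T.card + 1))
                  ≤ (T.card + 1) * (ε / (T.card + 1)) := by gcongr; simp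
                _ ≤ ε := ENNReal.mul_div_le
    have hφψ : ∫⁻ ω, ENNReal.ofReal ((φ ω - ψ ω) ^ 2) ∂(productMeasure d ν) ≤ 4 * ε := by
      calc _ ≤ ∫⁻ ω, (2 * ENNReal.ofReal ((F ω - φ ω) ^ 2) +
            2 * ENNReal.ofReal ((F ω - ψ ω) ^ 2)) ∂(productMeasure d ν) := by
            refine lintegral_mono fun ω => ?_
            rw [← hsymm]
            refine le_trans (le_of_eq ?_) (ofReal_add_sq_le _ _)
            ring_nf
        _ ≤ 2 * ε + 2 * ε := by
            rw [lintegral_add_left (by fun_prop), lintegral_const_mul' _ _ (by simp),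
              lintegral_const_mul' _ _ (by simp)]
            gcongr
        _ = _ := by ring
    have h107 : ENNReal.ofReal (10 / 7) ≤ 2 := ENNReal.ofReal_le_of_le_toReal (by norm_num)
    have h87 : ENNReal.ofReal (8 / 7) ≤ 2 := ENNReal.ofReal_le_of_le_toReal (by norm_num)
    calc evariance F (productMeasure d ν)
        ≤ 2 * evariance φ (productMeasure d ν) + 2 * ε :=
          (evariance_le_two_mul_add (Lp.memLp f) hφL).trans (by gcongr)
      _ ≤ 2 * (2 * (2 * dirichlet starInfluence G ν F + 2 * ε) + 2 * (4 * ε)) + 2 * ε := by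
          gcongr
          exact hlocal.trans (by gcongr)
      _ = _ := by ring
  refine ENNReal.le_of_forall_pos_le_add fun ε hε _ => ?_
  refine (key (ε / 26) (ENNReal.div_pos (by simpa using hε.ne') (by simp))).trans ?_
  gcongr
  exact ENNReal.mul_div_le

theorem le_gap {G : Set S} (hq : 1 - 1 / (40 * 2 ^ d * (1 + 2 ^ d)) ≤ ν.real G) :
    1 / 8 ≤ gap (d := d) starInfluence G ν := by
  refine le_iInf fun f => le_iInf₂ fun hf hconst => ?_
  have hfin : evariance f (productMeasure d ν) ≠ ∞ := evariance_ne_top (Lp.memLp f)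
  have hne : evariance f (productMeasure d ν) ≠ 0 := by
    rw [ne_eq, evariance_eq_zero_iff (Lp.aestronglyMeasurable f).aemeasurable]
    exact fun h => hconst ⟨_, h⟩
  rw [ENNReal.le_div_iff_mul_le (.inl hne) (.inl hfin), one_div, mul_comm,
    ← div_eq_mul_inv]
  exact ENNReal.div_le_of_le_mul' (evariance_le_dirichlet ν hq hf)

end InfiniteVolumePoincare

end KCSM

theorem mainTheorem2 (d : ℕ) (hd : 1 ≤ d) :
    ∃ q₀ : ℝ, q₀ < 1 ∧
      ∀ (S : Type*) [Finite S] [MeasurableSpace S] [MeasurableSingletonClass S]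
        (ν : Measure S) [IsProbabilityMeasure ν], (∀ s, 0 < ν {s}) →
        ∀ G : Set S, q₀ < ν.real G →
          (1 / 2 : ℝ≥0∞) <
              (⨅ (Λ : Finset (KCSM.Site d)) (τ : KCSM.Site d → S)
                (_ : ∀ y ∈ KCSM.starOrientedBoundary Λ, τ y ∈ G),
                KCSM.finiteGap KCSM.starInfluence G ν Λ τ) ∧
            0 < KCSM.gap (d := d) KCSM.starInfluence G ν := by
  refine ⟨1 - 1 / (40 * 2 ^ d * (1 + 2 ^ d)), sub_lt_self _ (by positivity), ?_⟩
  intro S _ _ _ ν _ hν G hq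
  refine ⟨?_, lt_of_lt_of_le (by simp) (KCSM.le_gap ν hq.le)⟩
  refine lt_of_lt_of_le ?_ (le_iInf fun Λ => le_iInf₂ fun τ hτ =>
    KCSM.le_finiteGap ν hν hq.le Λ hτ)
  rw [ENNReal.lt_ofReal_iff_toReal_lt (by simp)]
  norm_num
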